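/- Let $\mathcal P$ be a POMDP with finite sets $S$, $\mathrm{Act}$, $\Omega$ of states, actions and observations, observation function $\mathrm{obs}\colon S\to\Omega$, and a partial transition function in which every state has an enabled action and states with the same observation have the same enabled actions. Write $\mathrm{post}(s,\alpha)$ for the set of possible successors of $s$ under $\alpha$ ($\alpha$ is enabled in $s$ iff this set is nonempty). Let $\mathrm{REACH},\mathrm{AVOID}\subseteq S$ be disjoint sets of absorbing states. **Belief supports.** A belief support is a nonempty set $b\subseteq S$ of states with the same observation. $\mathrm{Post}(b,\alpha)$ is the set of all nonempty sets of the form $\{s'\mid \mathrm{obs}(s')=z,\ \exists s\in b\colon s'\in \mathrm{post}(s,\alpha)\}$ with $z\in\Omega$. A belief support $b$ is *winning* if there is an observation-based (history-dependent, randomized) policy that, from every initial distribution with support $b$, reaches $\mathrm{AVOID}$ with probability $0$ and $\mathrm{REACH}$ with probability $1$. A *winning region* is a set of winning belief supports. A *safe path* in a set $W$ of belief supports is a sequence $b_0\alpha_1b_1\dots\alpha_n b_n$ with all $b_i\in W$ and, for $1\le i\le n$, $\alpha_i$ enabled in $b_{i-1}$, $b_i\in\mathrm{Post}(b_{i-1},\alpha_i)$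 and $\mathrm{Post}(b_{i-1},\alpha_i)\subseteq W$. $W$ is *productive* if from every $b\in W$ there is a safe path in $W$ to some $b_n\subseteq\mathrm{REACH}$. **Algorithm 2.** The algorithm maintains for each $z\in\Omega$ a finite list $\mathsf{Win}(z)=(\mathsf{Win}(z)_1,\dots,\mathsf{Win}(z)_m)$ of distinct sets of states with observation $z$, where $m=|\mathsf{Win}(z)|$ and $\mathsf{Win}(z)_0:=\emptyset$; initially it stores the set $\{s\in\mathrm{REACH}\mid\mathrm{obs}(s)=z\}$. While the following constraints have a solution, it takes an arbitrary solution and, for every $z$, adds $\{s\mid C_s\text{ true},\ \mathrm{obs}(s)=z\}$ to $\mathsf{Win}(z)$. (Non-maximal and empty sets may be dropped, and the order of the list is arbitrary.) The variables are Booleans $A_{z,\alpha},C_s,D_s,U_z,\mathit{sw}_z$, natural numbers $p_z$ and reals $r_s$. The constraints are: 1. Some $U_z$ is true. If $\mathsf{Win}(z)=\emptyset$ then $U_z\leftrightarrow\bigvee_{\mathrm{obs}(s)=z}C_s$; otherwise $U_z\leftrightarrow\bigwedge_{X\in\mathsf{Win}(z)}\bigvee_{s\notin X,\,\mathrm{obs}(s)=z}C_s$.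 2. For every occurring observation $z$, $A_{z,\alpha}$ is true for some $\alpha$ enabled at $z$; and $\neg C_s\wedge\neg D_s$ for $s\in\mathrm{AVOID}$. 3. For all $s$ and all $\alpha$ enabled in $s$: $C_s\wedge A_{\mathrm{obs}(s),\alpha}\wedge\neg \mathit{sw}_{\mathrm{obs}(s)}\to\bigwedge_{s'\in\mathrm{post}(s,\alpha)}C_{s'}$ and $C_s\wedge A_{\mathrm{obs}(s),\alpha}\wedge \mathit{sw}_{\mathrm{obs}(s)}\to\bigwedge_{s'\in\mathrm{post}(s,\alpha)}D_{s'}$. 4. $D_s\to p_{\mathrm{obs}(s)}>0$; $p_z\le|\mathsf{Win}(z)|$; and $D_s\to p_z\ne i$ for all $z$, all $0\le i\le|\mathsf{Win}(z)|$ and all $s\notin\mathsf{Win}(z)_i$ with $\mathrm{obs}(s)=z$. 5. For $s\notin\mathrm{REACH}\cup\mathrm{AVOID}$: $C_s\to\mathit{sw}_{\mathrm{obs}(s)}\vee\bigvee_{\alpha\text{ enabled in }s}\bigl(A_{\mathrm{obs}(s),\alpha}\wedge\bigvee_{s'\in\mathrm{post}(s,\alpha)}r_s>r_{s'}\bigr)$.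 $\mathsf{Win}$ encodes the set $W$ of all nonempty subsets of the sets stored in some $\mathsf{Win}(z)$. **Theorem.** In every execution and after every number of iterations (including none), all stored nonempty sets belong to $W$, and * $W$ is a winning region; * for every $b\in W$ and $s\in b$ there are a safe path $b_0\alpha_1b_1\dots b_n$ in $W$ with $b_0=b$ and states $s_i\in b_i$ with $s_0=s$, $s_i\in\mathrm{post}(s_{i-1},\alpha_i)$ for $1\le i\le n$, and $s_n\in\mathrm{REACH}$; * if no state in $\mathrm{REACH}$ has the same observation as a state outside $\mathrm{REACH}\cup\mathrm{AVOID}$, then $W$ is productive. Moreover, the algorithm terminates: there is a bound $N$ (depending on the input) such that every execution performs at most $N$ iterations. -/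

import Mathlib

open MeasureTheory ProbabilityTheory

noncomputable section

/-- A partially observable Markov decision process with states `S`, actions `Act` and
observations `Ω`. The transition function is partial: `trans s α = none` means that action `α` is
not available in `s`. -/
structure POMDP (S Act Ω : Type*) where
  /-- the initial distribution -/
  init : PMF S
  /-- the (partial) transition function -/
  trans : S → Act → Option (PMF S)
  /-- the observation function -/
  obs : S → Ω
  /-- there is a unique initial observation -/
  init_obs : ∃ z, obs '' init.support = {z}
  /-- every state has an available action -/
  exists_enabled : ∀ s, ∃ α, (trans s α).isSome
  /-- states with the same observation share the set of available actions -/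
  enabled_congr : ∀ s s' α, obs s = obs s' → ((trans s α).isSome ↔ (trans s' α).isSome)

namespace POMDP

variable {S Act Ω : Type*} (P : POMDP S Act Ω)

/-- The set of possible successors of `s` under `α`; empty if `α` is not available. -/
def post (s : S) (α : Act) : Set S := {s' | ∃ μ, P.trans s α = some μ ∧ s' ∈ μ.support}

/-- The actions that are available in `s`. -/
def enabled (s : S) : Set Act := {α | (P.post s α).Nonempty}

/-- The actions that are available in the states with observation `z`. -/
def enabledObs (z : Ω) : Set Act := {α | ∃ s, P.obs s = z ∧ α ∈ P.enabled s}

/-- A state is absorbing if every available action leads back to it with probability one. -/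
def Absorbing (s : S) : Prop := ∀ α ∈ P.enabled s, P.post s α = {s}

/-- The successor distribution. The default value in the case of an unavailable action is
irrelevant, as policies select available actions only. -/
def succDist (s : S) (α : Act) : PMF S := (P.trans s α).getD (PMF.pure s)

/-- A reach-avoid specification: disjoint sets of absorbing states. -/
structure ReachAvoid where
  reach : Set S
  avoid : Set S
  disjoint : Disjoint reach avoid
  reach_absorbing : ∀ s ∈ reach, P.Absorbing s
  avoid_absorbing : ∀ s ∈ avoid, P.Absorbing s

/-! ### Policies and induced probability measure -/

/-- A policy maps a finite path `(s₀, α₀) … (sₙ₋₁, αₙ₋₁) sₙ` to a distribution over the actions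
available in its last state. -/
structure Policy where
  act : List (S × Act) × S → PMF Act
  support_subset : ∀ π, (act π).support ⊆ P.enabled π.2

/-- The observation-action sequence of a finite path. -/
def obsPath (π : List (S × Act) × S) : List (Ω × Act) × Ω :=
  (π.1.map fun p => (P.obs p.1, p.2), P.obs π.2)

variable {P} in
/-- Observation-based policies do not distinguish paths with the same observation sequence. -/
def Policy.ObservationBased (σ : P.Policy) : Prop :=
  ∀ π π', P.obsPath π = P.obsPath π' → σ.act π = σ.act π'

end POMDP

/-- One entry of a run: a state and the action that is selected there. -/
structure RunStep (S Act : Type*) where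
  state : S
  action : Act

namespace RunStep

variable {S Act : Type*}

instance : MeasurableSpace (RunStep S Act) := ⊤

instance : DiscreteMeasurableSpace (RunStep S Act) := ⟨fun _ => trivial⟩

instance [Finite S] [Finite Act] : Finite (RunStep S Act) :=
  Finite.of_injective (fun x => (x.state, x.action)) (by
    rintro ⟨a, b⟩ ⟨c, d⟩ h
    simpa using h)

end RunStep

namespace POMDP

variable {S Act Ω : Type*} {P : POMDP S Act Ω}

namespace Policy

variable (σ : P.Policy)

/-- The history `(s₀, α₀) … (sₙ, αₙ)` as a list. -/
def histList {n : ℕ} (x : (i : Finset.Iic n) → RunStep S Act) : List (S × Act) :=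
  List.ofFn fun i : Fin (n + 1) =>
    let y := x ⟨i, Finset.mem_Iic.2 (Nat.lt_succ_iff.1 i.2)⟩
    (y.state, y.action)

/-- The law of `(s₀, α₀)`: the state is drawn from the belief, the action from the policy. -/
def initStep (μ : PMF S) : PMF (RunStep S Act) :=
  μ.bind fun s => (σ.act ([], s)).map fun α => ⟨s, α⟩

/-- The law of `(sₙ₊₁, αₙ₊₁)` given the history `(s₀, α₀) … (sₙ, αₙ)`. -/
def nextStep {n : ℕ} (x : (i : Finset.Iic n) → RunStep S Act) : PMF (RunStep S Act) :=
  let y := x ⟨n, Finset.mem_Iic.2 le_rfl⟩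
  (P.succDist y.state y.action).bind fun s' =>
    (σ.act (histList x, s')).map fun α' => ⟨s', α'⟩

/-- `Policy.nextStep` as a Markov kernel. -/
def stepKernel [Finite S] [Finite Act] (n : ℕ) :
    Kernel ((i : Finset.Iic n) → RunStep S Act) (RunStep S Act) where
  toFun x := (σ.nextStep x).toMeasure
  measurable' := Measurable.of_discrete

instance [Finite S] [Finite Act] (n : ℕ) : IsMarkovKernel (σ.stepKernel n) :=
  ⟨fun x => inferInstanceAs (IsProbabilityMeasure (σ.nextStep x).toMeasure)⟩

/-- The probability measure on infinite runs that the policy induces from a belief. -/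
def runMeasure [Finite S] [Finite Act] (μ : PMF S) : Measure (ℕ → RunStep S Act) :=
  Kernel.trajMeasure (X := fun _ => RunStep S Act) (σ.initStep μ).toMeasure σ.stepKernel

/-- The probability to reach a state in `T` from a belief under the policy. -/
def prReach [Finite S] [Finite Act] (μ : PMF S) (T : Set S) : ENNReal :=
  σ.runMeasure μ {ω | ∃ n, (ω n).state ∈ T}

/-- The policy is winning from a belief: `avoid` is reached with probability zero and `reach` with
probability one. -/
def WinningFrom [Finite S] [Finite Act] (φ : P.ReachAvoid) (μ : PMF S) : Prop :=
  σ.prReach μ φ.avoid = 0 ∧ σ.prReach μ φ.reach = 1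

end Policy

/-! ### Belief supports and regions -/

variable (P) in
/-- Belief supports: nonempty sets of states that share one observation. -/
def IsBeliefSupport (b : Set S) : Prop :=
  b.Nonempty ∧ ∀ s ∈ b, ∀ s' ∈ b, P.obs s = P.obs s'

variable (P) in
/-- The states with observation `z` that can be entered from `b` with action `α`. -/
def succOn (b : Set S) (α : Act) (z : Ω) : Set S :=
  {s' | P.obs s' = z ∧ ∃ s ∈ b, s' ∈ P.post s α}

variable (P) in
/-- Successors of `b` under `α` in the belief-support MDP: the supports of the beliefs obtained by
taking `α` and conditioning on an observation that has positive probability. -/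
def postSupp (b : Set S) (α : Act) : Set (Set S) :=
  {b' | ∃ z, b' = P.succOn b α z ∧ b'.Nonempty}

variable (P) in
/-- The actions available at a belief support. -/
def enabledSupp (b : Set S) : Set Act := {α | ∀ s ∈ b, α ∈ P.enabled s}

/-- A belief support is winning if some observation-based policy is winning from the beliefs with
that support. -/
def WinningSupport [Finite S] [Finite Act] (φ : P.ReachAvoid) (b : Set S) : Prop :=
  ∃ σ : P.Policy, σ.ObservationBased ∧ ∀ μ : PMF S, μ.support = b → σ.WinningFrom φ μ

/-- A winning region is a set of winning belief supports. -/
def WinningRegion [Finite S] [Finite Act] (φ : P.ReachAvoid) (W : Set (Set S)) : Prop :=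
  ∀ b ∈ W, P.IsBeliefSupport b ∧ WinningSupport φ b

variable (P) in
/-- `b 0, α 0, b 1, …, α (n - 1), b n` is a path in the belief-support MDP that is contained in
`W`, and each action that it uses leads to belief supports in `W` only. -/
def SafePath (W : Set (Set S)) (n : ℕ) (b : ℕ → Set S) (α : ℕ → Act) : Prop :=
  (∀ i ≤ n, b i ∈ W) ∧
    ∀ i < n, α i ∈ P.enabledSupp (b i) ∧ b (i + 1) ∈ P.postSupp (b i) (α i) ∧
      P.postSupp (b i) (α i) ⊆ W

/-- `W` is productive: from each of its elements there is a safe path to a belief support that is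
contained in `reach`. -/
def Productive (φ : P.ReachAvoid) (W : Set (Set S)) : Prop :=
  ∀ b₀ ∈ W, ∃ n b α, P.SafePath W n b α ∧ b 0 = b₀ ∧ b n ⊆ φ.reach

/-- From each state of each element of `W` there is a path of the POMDP to a state in `reach` that
runs along a safe path of belief supports. -/
def StatewiseProductive (φ : P.ReachAvoid) (W : Set (Set S)) : Prop :=
  ∀ b₀ ∈ W, ∀ s₀ ∈ b₀, ∃ n b α, P.SafePath W n b α ∧ b 0 = b₀ ∧
    ∃ s : ℕ → S, s 0 = s₀ ∧ (∀ i ≤ n, s i ∈ b i) ∧ (∀ i < n, s (i + 1) ∈ P.post (s i) (α i)) ∧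
      s n ∈ φ.reach

/-- No state in `reach` shares its observation with a state outside `reach ∪ avoid`. -/
def ReachObservable (φ : P.ReachAvoid) : Prop :=
  ∀ s ∈ φ.reach, ∀ s', s' ∉ φ.reach → s' ∉ φ.avoid → P.obs s ≠ P.obs s'

/-! ### The encoding -/

/-- The data structure `Win`: a list of sets of states for each observation. -/
abbrev WinData (S Ω : Type*) := Ω → List (Set S)

/-- Assignments to the variables of the encoding. -/
structure Assignment (S Act Ω : Type*) where
  /-- `A z α`: action `α` is selected upon observation `z` -/
  A : Ω → Act → Prop
  /-- `C s`: state `s` is reached -/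
  C : S → Prop
  /-- `D s`: a shortcut is taken in state `s` -/
  D : S → Prop
  /-- `idx z`: the index of the shortcut used for observation `z`; `0` stands for none -/
  idx : Ω → ℕ
  /-- `switch z`: from states with observation `z`, take an action and then a shortcut -/
  switch : Ω → Prop
  /-- `U z`: a new belief support with observation `z` has been found -/
  U : Ω → Prop
  /-- `rank s`: the real-valued rank of `s` -/
  rank : S → ℝ

/-- The `i`-th entry of a list, for `1 ≤ i ≤ L.length`; the entry with index `0` is empty. -/
def entry (L : List (Set S)) : ℕ → Set S
  | 0 => ∅
  | i + 1 => L.getD i ∅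

/-- `η` satisfies the encoding for the specification `φ` and the current content `w` of `Win`. -/
structure Satisfies (φ : P.ReachAvoid) (w : WinData S Ω) (η : Assignment S Act Ω) : Prop where
  progress : ∃ z, η.U z
  updated_of_empty : ∀ z, w z = [] → (η.U z ↔ ∃ s, P.obs s = z ∧ η.C s)
  updated_of_nonempty : ∀ z, w z ≠ [] →
    (η.U z ↔ ∀ X ∈ w z, ∃ s, s ∉ X ∧ P.obs s = z ∧ η.C s)
  action : ∀ z ∈ Set.range P.obs, ∃ α ∈ P.enabledObs z, η.A z α
  avoid : ∀ s ∈ φ.avoid, ¬ η.C s ∧ ¬ η.D s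
  closed : ∀ s, ∀ α ∈ P.enabled s, η.C s ∧ η.A (P.obs s) α ∧ ¬ η.switch (P.obs s) →
    ∀ s' ∈ P.post s α, η.C s'
  closed_switch : ∀ s, ∀ α ∈ P.enabled s, η.C s ∧ η.A (P.obs s) α ∧ η.switch (P.obs s) →
    ∀ s' ∈ P.post s α, η.D s'
  shortcut_pos : ∀ s, η.D s → 0 < η.idx (P.obs s)
  shortcut_le : ∀ z, η.idx z ≤ (w z).length
  shortcut_mem : ∀ z, ∀ i ≤ (w z).length, ∀ s, s ∉ entry (w z) i → P.obs s = z →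
    η.D s → η.idx z ≠ i
  ranking : ∀ s, s ∉ φ.reach → s ∉ φ.avoid → η.C s →
    (∃ α ∈ P.enabled s, η.A (P.obs s) α ∧ ∃ s' ∈ P.post s α, η.rank s > η.rank s') ∨
      η.switch (P.obs s)

/-! ### The algorithm -/

/-- The list `L` stores the family `F` of sets: it enumerates, without repetition, members of `F`,
and every nonempty member of `F` is contained in an entry. In particular, one may store all of `F`
or its maximal members only, and the empty set need not be stored. -/
structure Stores (L : List (Set S)) (F : Set (Set S)) : Prop where
  nodup : L.Nodup
  sound : ∀ X ∈ L, X ∈ F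
  covers : ∀ X ∈ F, X.Nonempty → ∃ Y ∈ L, X ⊆ Y

/-- Initialization: `Win z` stores the set of states in `reach` with observation `z`. -/
def IsInitial (φ : P.ReachAvoid) (w : WinData S Ω) : Prop :=
  ∀ z, Stores (w z) {{s | s ∈ φ.reach ∧ P.obs s = z}}

/-- One iteration of the loop: the solver returns some satisfying assignment `η`, and for each `z`
the set `{s | obs s = z ∧ η(C s)}` is added to `Win z`. -/
def Iteration (φ : P.ReachAvoid) (w w' : WinData S Ω) : Prop :=
  ∃ η, Satisfies φ w η ∧
    ∀ z, Stores (w' z) ({X | X ∈ w z} ∪ {{s | P.obs s = z ∧ η.C s}})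

/-- `AfterIterations φ n w`: some execution has content `w` of `Win` after `n` iterations. -/
inductive AfterIterations (φ : P.ReachAvoid) : ℕ → WinData S Ω → Prop
  | init {w} : IsInitial φ w → AfterIterations φ 0 w
  | step {n w w'} : AfterIterations φ n w → Iteration φ w w' → AfterIterations φ (n + 1) w'

variable (P) in
/-- The set of belief supports that `Win` encodes: the nonempty subsets of the stored sets. -/
def encodedRegion (w : WinData S Ω) : Set (Set S) :=
  {b | b.Nonempty ∧ ∃ z, (∀ s ∈ b, P.obs s = z) ∧ ∃ X ∈ w z, b ⊆ X}

end POMDP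

end

/-! The loop maintains an invariant: stored sets have the right observation and miss `avoid`, and
the encoded region W is statewise productive. A solution preserves it
(`Satisfies.safelyReaches_of_C`). Take a support b inside the new set and s in b. Without a switch,
some selected action lets s move to a state of smaller rank, while the closure of C keeps every
successor support inside the new sets; finiteness of the state space makes induction on the rank
possible. With a switch, all successor supports consist of D-states, hence lie in one old stored
set, and the old paths take over.

Statewise productivity suffices for winning (`StatewiseProductive.winningRegion`). Let the policy
track the belief support and choose uniformly among safe actions. Support, state and action then
form a finite Markov chain that never leaves W, and each of its nodes can reach the absorbing set
`reach`, so it does so almost surely (`PMF.iSup_hitProb_eq_one`, a minimum principle).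

For termination, `U` provides a set that no stored set contains, so W grows strictly inside the
finite family of sets of states (`Iteration.encodedRegion_ssubset`). -/

noncomputable section

open scoped ENNReal

/-! ### Expectations with respect to probability mass functions -/

namespace PMF

variable {α β : Type*}

/-- The expectation of an extended nonnegative function. -/
def expect (p : PMF α) (f : α → ℝ≥0∞) : ℝ≥0∞ := ∑' a, p a * f a

theorem expect_const (p : PMF α) (c : ℝ≥0∞) : p.expect (fun _ => c) = c := by
  simp [expect, ENNReal.tsum_mul_right]

theorem expect_congr {p : PMF α} {f g : α → ℝ≥0∞} (h : ∀ a ∈ p.support, f a = g a) :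
    p.expect f = p.expect g := by
  refine tsum_congr fun a => ?_
  by_cases ha : p a = 0
  · simp [ha]
  · rw [h a ha]

theorem expect_mono {p : PMF α} {f g : α → ℝ≥0∞} (h : ∀ a, f a ≤ g a) :
    p.expect f ≤ p.expect g :=
  ENNReal.tsum_le_tsum fun a => by gcongr; exact h a

theorem expect_pure (a : α) (f : α → ℝ≥0∞) : (PMF.pure a).expect f = f a := by
  classical
  rw [expect, tsum_eq_single a]
  · simp
  · intro b hb
    simp [hb]

theorem expect_bind (p : PMF α) (q : α → PMF β) (f : β → ℝ≥0∞) :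
    (p.bind q).expect f = p.expect fun a => (q a).expect f := by
  simp only [expect, PMF.bind_apply, ← ENNReal.tsum_mul_right, ← ENNReal.tsum_mul_left]
  rw [ENNReal.tsum_comm]
  simp only [mul_assoc]

theorem expect_map (p : PMF α) (g : α → β) (f : β → ℝ≥0∞) :
    (p.map g).expect f = p.expect fun a => f (g a) := by
  rw [PMF.map, expect_bind]
  simp only [Function.comp_apply, expect_pure]

theorem expect_iSup [Finite α] (p : PMF α) {f : ℕ → α → ℝ≥0∞} (hf : Monotone f) :
    p.expect (fun a => ⨆ n, f n a) = ⨆ n, p.expect (f n) := by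
  have := Fintype.ofFinite α
  simp only [expect, tsum_fintype, ENNReal.mul_iSup]
  refine ENNReal.finsetSum_iSup_of_monotone fun a m n hmn => ?_
  gcongr
  exact hf hmn a

theorem lintegral_toMeasure [Countable α] [MeasurableSpace α] [MeasurableSingletonClass α]
    (p : PMF α) (f : α → ℝ≥0∞) : ∫⁻ a, f a ∂p.toMeasure = p.expect f := by
  rw [lintegral_countable']
  refine tsum_congr fun a => ?_
  rw [p.toMeasure_apply_singleton a (measurableSet_singleton a), mul_comm]

/-- If a function is bounded below by its expectation on the support, it is constant there. -/
theorem eq_of_expect_le {p : PMF α} {f : α → ℝ≥0∞} {c : ℝ≥0∞} (hc : c ≠ ∞)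
    (hf : ∀ a ∈ p.support, c ≤ f a) (h : p.expect f ≤ c) : ∀ a ∈ p.support, f a = c := by
  intro a ha
  by_contra hne
  have hlt : c < f a := lt_of_le_of_ne (hf a ha) (Ne.symm hne)
  have : ∑' b, p b * c < ∑' b, p b * f b := by
    refine ENNReal.tsum_lt_tsum (i := a) ?_ (fun b => ?_) ?_
    · simpa [ENNReal.tsum_mul_right] using hc
    · by_cases hb : p b = 0
      · simp [hb]
      · gcongr
        exact hf b hb
    · exact (ENNReal.mul_lt_mul_iff_right ha (p.apply_ne_top a)).2 hlt
  have h2 : ∑' b, p b * c = c := p.expect_const c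
  rw [h2] at this
  exact absurd h (not_le.2 this)

/-- The probability that a Markov chain is in `T` after `n` steps. -/
def hitProb {N : Type*} (p : N → PMF N) (T : Set N) : ℕ → N → ℝ≥0∞
  | 0 => T.indicator 1
  | n + 1 => fun u => (p u).expect (hitProb p T n)

/-- As `T` is never left, being in `T` at time `n` means having entered it by time `n`. -/
theorem hitProb_mono {N : Type*} {p : N → PMF N} {T : Set N}
    (hT : ∀ u ∈ T, (p u).support ⊆ T) : Monotone (hitProb p T) := by
  refine monotone_nat_of_le_succ fun n => ?_
  induction n with
  | zero =>
    intro u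
    by_cases hu : u ∈ T
    · have : (p u).expect (T.indicator 1) = (p u).expect (fun _ => 1) :=
        expect_congr fun v hv => by simp [hT u hu hv]
      simp [hitProb, hu, this, expect_const]
    · simp [hitProb, hu]
  | succ n ih => exact fun u => expect_mono ih

theorem hitProb_le_one {N : Type*} (p : N → PMF N) (T : Set N) (n : ℕ) (u : N) :
    hitProb p T n u ≤ 1 := by
  induction n generalizing u with
  | zero => exact Set.indicator_le_self' (by simp) u
  | succ n ih => exact (expect_mono ih).trans (expect_const _ _).le

/-- In a finite Markov chain, a closed set `T` that can be reached from each element of a closed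
set `G` is reached almost surely from there. -/
theorem iSup_hitProb_eq_one {N : Type*} [Finite N] {p : N → PMF N} {T G : Set N}
    (hT : ∀ u ∈ T, (p u).support ⊆ T) (hG : ∀ u ∈ G, (p u).support ⊆ G)
    (hreach : ∀ u ∈ G, ∃ v ∈ T, Relation.ReflTransGen (fun x y => y ∈ (p x).support) u v)
    {u : N} (hu : u ∈ G) : ⨆ n, hitProb p T n u = 1 := by
  set L : N → ℝ≥0∞ := fun u => ⨆ n, hitProb p T n u with hL
  have hmono := hitProb_mono hT
  have hL1 : ∀ v, L v ≤ 1 := fun v => iSup_le fun n => hitProb_le_one p T n v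
  have hLT : ∀ v ∈ T, 1 ≤ L v := fun v hv =>
    le_iSup_of_le 0 (by simp [hitProb, hv])
  -- `L` is harmonic: shifting a monotone sequence by one does not change its supremum.
  have hharm : ∀ v, (p v).expect L = L v := fun v => by
    rw [hL, expect_iSup _ hmono]
    refine le_antisymm (iSup_le fun n => le_iSup_of_le (n + 1) le_rfl) ?_
    exact iSup_le fun n => le_iSup_of_le n (hmono n.le_succ v)
  obtain ⟨w, hw, hmin⟩ := Set.exists_min_image G L (Set.toFinite G) ⟨u, hu⟩
  -- Minimum principle: a harmonic function that is minimal at a point of `G` takes the same value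
  -- at all its successors, so the minimum propagates along paths into `T`, where `L` is 1.
  have hpath : ∀ x y, Relation.ReflTransGen (fun x y => y ∈ (p x).support) x y →
      x ∈ G → L x = L w → L y = L w := by
    intro x y hxy
    induction hxy using Relation.ReflTransGen.head_induction_on with
    | refl => exact fun _ h => h
    | head h _ ih =>
      intro hx hxw
      refine ih (hG _ hx h) ?_
      exact eq_of_expect_le (ne_top_of_le_ne_top ENNReal.one_ne_top (hL1 w))
        (fun a ha => hmin a (hG _ hx ha)) ((hharm _).trans hxw).le _ h
  obtain ⟨v, hv, hwv⟩ := hreach w hw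
  refine le_antisymm (hL1 u) ?_
  calc 1 ≤ L v := hLT v hv
    _ = L w := hpath w v hwv hw rfl
    _ ≤ L u := hmin u hu

end PMF

/-! ### Finite Markov chains -/

/-- The process `Y` is a Markov chain with transition function `p` under the measure `m`. -/
structure IsMarkovChain {E N : Type*} [MeasurableSpace E] (m : Measure E) (Y : ℕ → E → N)
    (p : N → PMF N) : Prop where
  measurableSet_preimage : ∀ n (s : Set N), MeasurableSet (Y n ⁻¹' s)
  -- This only relates the laws at times `n` and `n + 1`, which is weaker than the Markov property.
  -- It suffices because only events at a single time are evaluated.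
  lintegral_succ : ∀ n (f : N → ℝ≥0∞), ∫⁻ ω, f (Y (n + 1) ω) ∂m = ∫⁻ ω, (p (Y n ω)).expect f ∂m

namespace IsMarkovChain

variable {E N : Type*} [MeasurableSpace E] {m : Measure E} {Y : ℕ → E → N} {p : N → PMF N}

theorem measurable_comp (h : IsMarkovChain m Y p) (n : ℕ) (f : N → ℝ≥0∞) :
    Measurable fun ω => f (Y n ω) :=
  fun s _ => h.measurableSet_preimage n (f ⁻¹' s)

theorem measure_mem (h : IsMarkovChain m Y p) (n : ℕ) (s : Set N) :
    m {ω | Y n ω ∈ s} = ∫⁻ ω, s.indicator 1 (Y n ω) ∂m :=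
  (lintegral_indicator_one (h.measurableSet_preimage n s)).symm

theorem ae_mem (h : IsMarkovChain m Y p) {G : Set N} (hG : ∀ u ∈ G, (p u).support ⊆ G)
    (h0 : ∀ᵐ ω ∂m, Y 0 ω ∈ G) (n : ℕ) : ∀ᵐ ω ∂m, Y n ω ∈ G := by
  induction n with
  | zero => exact h0
  | succ n ih =>
    change m {ω | Y (n + 1) ω ∈ Gᶜ} = 0
    rw [h.measure_mem, h.lintegral_succ, lintegral_eq_zero_iff (h.measurable_comp n fun u =>
      (p u).expect (Gᶜ.indicator 1))]
    filter_upwards [ih] with ω hω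
    have : (p (Y n ω)).expect (Gᶜ.indicator 1) = (p (Y n ω)).expect fun _ => 0 :=
      PMF.expect_congr fun v hv => by simp [hG _ hω hv]
    simp [this, PMF.expect_const]

theorem measure_mem_eq_lintegral_hitProb (h : IsMarkovChain m Y p) (T : Set N) (n : ℕ) :
    m {ω | Y n ω ∈ T} = ∫⁻ ω, PMF.hitProb p T n (Y 0 ω) ∂m := by
  -- Each use of `lintegral_succ` trades one unit of time for one more step inside `hitProb`; hence
  -- the general `k`.
  have key : ∀ k n, ∫⁻ ω, PMF.hitProb p T k (Y n ω) ∂m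
      = ∫⁻ ω, PMF.hitProb p T (k + n) (Y 0 ω) ∂m := by
    intro k n
    induction n generalizing k with
    | zero => rfl
    | succ n ih =>
      rw [h.lintegral_succ, show k + (n + 1) = k + 1 + n by omega, ← ih]
      rfl
  rw [h.measure_mem, ← zero_add n, ← key 0 n, zero_add]
  rfl

theorem measure_exists_mem_eq_one [Finite N] [IsProbabilityMeasure m] (h : IsMarkovChain m Y p)
    {T G : Set N} (hT : ∀ u ∈ T, (p u).support ⊆ T) (hG : ∀ u ∈ G, (p u).support ⊆ G)
    (hreach : ∀ u ∈ G, ∃ v ∈ T, Relation.ReflTransGen (fun x y => y ∈ (p x).support) u v)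
    (h0 : ∀ᵐ ω ∂m, Y 0 ω ∈ G) : m {ω | ∃ n, Y n ω ∈ T} = 1 := by
  refine le_antisymm prob_le_one ?_
  calc (1 : ℝ≥0∞) = ∫⁻ ω, ⨆ n, PMF.hitProb p T n (Y 0 ω) ∂m := by
        rw [lintegral_congr_ae (g := fun _ => 1)]
        · simp
        · filter_upwards [h0] with ω hω
          exact PMF.iSup_hitProb_eq_one hT hG hreach hω
    _ = ⨆ n, ∫⁻ ω, PMF.hitProb p T n (Y 0 ω) ∂m :=
        lintegral_iSup (fun n => h.measurable_comp 0 _)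
          fun _ _ hmn ω => PMF.hitProb_mono hT hmn (Y 0 ω)
    _ ≤ m {ω | ∃ n, Y n ω ∈ T} := by
        refine iSup_le fun n => ?_
        rw [← h.measure_mem_eq_lintegral_hitProb]
        exact measure_mono fun ω hω => ⟨n, hω⟩

end IsMarkovChain

namespace POMDP

variable {S Act Ω : Type*} {P : POMDP S Act Ω}

/-! ### Available actions -/

theorem mem_enabled_iff {s : S} {α : Act} : α ∈ P.enabled s ↔ (P.trans s α).isSome := by
  constructor
  · rintro ⟨s', μ, hμ, -⟩
    simp [hμ]
  · intro h
    obtain ⟨μ, hμ⟩ := Option.isSome_iff_exists.1 h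
    obtain ⟨s', hs'⟩ := μ.support_nonempty
    exact ⟨s', μ, hμ, hs'⟩

theorem enabled_nonempty (s : S) : (P.enabled s).Nonempty := by
  obtain ⟨α, hα⟩ := P.exists_enabled s
  exact ⟨α, mem_enabled_iff.2 hα⟩

theorem mem_enabled_congr {s s' : S} (h : P.obs s = P.obs s') {α : Act}
    (hα : α ∈ P.enabled s) : α ∈ P.enabled s' :=
  mem_enabled_iff.2 ((P.enabled_congr s s' α h).1 (mem_enabled_iff.1 hα))

theorem enabledObs_obs (s : S) : P.enabledObs (P.obs s) = P.enabled s := by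
  ext α
  exact ⟨fun ⟨_, h, hα⟩ => mem_enabled_congr h hα, fun hα => ⟨s, rfl, hα⟩⟩

theorem support_succDist {s : S} {α : Act} (hα : α ∈ P.enabled s) :
    (P.succDist s α).support = P.post s α := by
  obtain ⟨μ, hμ⟩ := Option.isSome_iff_exists.1 (mem_enabled_iff.1 hα)
  ext s'
  simp [succDist, post, hμ]

theorem Absorbing.support_succDist_subset {s : S} (hs : P.Absorbing s) (α : Act) :
    (P.succDist s α).support ⊆ {s} := by
  by_cases hα : α ∈ P.enabled s
  · rw [support_succDist hα, hs α hα]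
  -- Here `succDist` takes its default value `PMF.pure s`, which also stays in `s`.
  · have : P.trans s α = none := by simpa [mem_enabled_iff] using hα
    simp [succDist, this]

/-! ### The law of the runs -/

section RunMeasure

variable [Finite S] [Finite Act] (σ : P.Policy) (μ : PMF S)

instance : IsProbabilityMeasure (σ.runMeasure μ) :=
  inferInstanceAs (IsProbabilityMeasure (Kernel.trajMeasure (X := fun _ => RunStep S Act)
    (σ.initStep μ).toMeasure σ.stepKernel))

theorem Policy.map_frestrictLe_zero_runMeasure :
    (σ.runMeasure μ).map (Preorder.frestrictLe 0) = (σ.initStep μ).toMeasure.map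
      (MeasurableEquiv.piUnique fun _ : Finset.Iic 0 => RunStep S Act).symm := by
  rw [Policy.runMeasure, Kernel.trajMeasure, Measure.map_comp _ _ (by fun_prop),
    Kernel.traj_map_frestrictLe, Kernel.partialTraj_self, Measure.id_comp]

theorem Policy.map_zero_runMeasure :
    (σ.runMeasure μ).map (fun ω => ω 0) = (σ.initStep μ).toMeasure := by
  have h : (fun ω : ℕ → RunStep S Act => ω 0) =
      (fun x : (i : Finset.Iic 0) → RunStep S Act => x ⟨0, Finset.mem_Iic.2 le_rfl⟩) ∘
        Preorder.frestrictLe 0 := rfl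
  rw [h, ← Measure.map_map (by fun_prop) (by fun_prop), σ.map_frestrictLe_zero_runMeasure,
    Measure.map_map (by fun_prop) (by fun_prop)]
  exact Measure.map_id

theorem Policy.ae_zero_mem_support :
    ∀ᵐ ω ∂σ.runMeasure μ, ω 0 ∈ (σ.initStep μ).support := by
  have h : ∀ᵐ y ∂(σ.runMeasure μ).map (fun ω => ω 0), y ∈ (σ.initStep μ).support := by
    rw [σ.map_zero_runMeasure]
    exact ((σ.initStep μ).toMeasure_apply_eq_zero_iff MeasurableSet.of_discrete).2
      disjoint_compl_right
  exact ae_of_ae_map (measurable_pi_apply (X := fun _ : ℕ => RunStep S Act) 0).aemeasurable h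

/-- Disintegration of the run measure at time `n`. The integrand may depend on the whole history,
since belief tracking does. -/
theorem Policy.lintegral_runMeasure_succ (n : ℕ)
    (g : ((i : Finset.Iic n) → RunStep S Act) → RunStep S Act → ℝ≥0∞) :
    ∫⁻ ω, g (Preorder.frestrictLe n ω) (ω (n + 1)) ∂σ.runMeasure μ =
      ∫⁻ ω, (σ.nextStep (Preorder.frestrictLe (π := fun _ => RunStep S Act) n ω)).expect
        (g (Preorder.frestrictLe n ω)) ∂σ.runMeasure μ := by
  have key := Kernel.map_frestrictLe_trajMeasure_compProd_eq_map_trajMeasure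
    (X := fun _ => RunStep S Act) (μ₀ := (σ.initStep μ).toMeasure) (κ := σ.stepKernel) (a := n)
  have hg : Measurable (Function.uncurry g) := Measurable.of_discrete
  have hm : Measurable fun ω : ℕ → RunStep S Act =>
      (Preorder.frestrictLe (π := fun _ => RunStep S Act) n ω, ω (n + 1)) :=
    (Preorder.measurable_frestrictLe n).prodMk (measurable_pi_apply _)
  have h1 : ∫⁻ ω, g (Preorder.frestrictLe n ω) (ω (n + 1)) ∂σ.runMeasure μ =
      ∫⁻ z, Function.uncurry g z ∂(σ.runMeasure μ).map
        (fun ω => (Preorder.frestrictLe n ω, ω (n + 1))) :=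
    (lintegral_map hg hm).symm
  rw [h1, Policy.runMeasure, ← key, Measure.lintegral_compProd hg, lintegral_map _ (by fun_prop)]
  · refine lintegral_congr fun ω => ?_
    exact PMF.lintegral_toMeasure _ _
  · exact Measurable.of_discrete

end RunMeasure

/-! ### Tracking the belief support -/

variable (P) in
/-- The states that can follow after an observation-action sequence, starting in `b`. -/
def predict (b : Set S) (l : List (Ω × Act)) : Set S :=
  l.foldl (fun F p => {s' | ∃ s ∈ F, P.obs s = p.1 ∧ s' ∈ P.post s p.2}) b

variable (P) in
/-- The belief support after an observation-action sequence, starting in `b`. -/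
def trackedBelief (b : Set S) (l : List (Ω × Act) × Ω) : Set S :=
  {s | s ∈ P.predict b l.1 ∧ P.obs s = l.2}

/-- `predict` filters by an observation only when it processes the action that follows it, so the
tracked support for `(l, z)` occurs as an intermediate stage of the fold. -/
theorem trackedBelief_concat (b : Set S) (l : List (Ω × Act)) (z : Ω) (α : Act) (z' : Ω) :
    P.trackedBelief b (l ++ [(z, α)], z') = P.succOn (P.trackedBelief b (l, z)) α z' := by
  ext s'
  simp only [trackedBelief, predict, succOn, List.foldl_append, List.foldl_cons, List.foldl_nil,
    Set.mem_ofPred_eq, and_assoc]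
  exact and_comm

theorem trackedBelief_nil {b : Set S} (hb : P.IsBeliefSupport b) {s : S} (hs : s ∈ b) :
    P.trackedBelief b ([], P.obs s) = b := by
  ext s'
  exact ⟨fun h => h.1, fun h => ⟨h, hb.2 _ h _ hs⟩⟩

variable (P) in
/-- The actions that lead from `b` to belief supports in `W` only. -/
def safeActions (W : Set (Set S)) (b : Set S) : Set Act :=
  {α | α ∈ P.enabledSupp b ∧ P.postSupp b α ⊆ W}

open Classical in
variable (P) in
/-- The safe actions if there are any, and all available actions otherwise. -/
def candidateActions (W : Set (Set S)) (b : Set S) (z : Ω) : Set Act :=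
  -- The intersection matters for `b = ∅`, where every action is vacuously safe, even an unavailable
  -- one.
  if (P.safeActions W b ∩ P.enabledObs z).Nonempty then P.safeActions W b ∩ P.enabledObs z
  else P.enabledObs z

theorem candidateActions_subset (W : Set (Set S)) (b : Set S) (z : Ω) :
    P.candidateActions W b z ⊆ P.enabledObs z := by
  unfold candidateActions
  split_ifs
  · exact Set.inter_subset_right
  · exact subset_rfl

theorem candidateActions_nonempty (W : Set (Set S)) (b : Set S) (s : S) :
    (P.candidateActions W b (P.obs s)).Nonempty := by
  unfold candidateActions
  split_ifs with h
  · exact h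
  · rw [enabledObs_obs]
    exact enabled_nonempty s

theorem candidateActions_eq {W : Set (Set S)} {b : Set S} {s : S} (hs : s ∈ b)
    (h : (P.safeActions W b).Nonempty) :
    P.candidateActions W b (P.obs s) = P.safeActions W b := by
  have : P.safeActions W b ∩ P.enabledObs (P.obs s) = P.safeActions W b := by
    rw [enabledObs_obs]
    exact Set.inter_eq_left.2 fun α hα => hα.1 s hs
  rw [candidateActions, this, if_pos h]

variable (P) in
/-- The observation-action sequence before time `n`. -/
def obsHistory (n : ℕ) (ω : ℕ → RunStep S Act) : List (Ω × Act) :=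
  List.ofFn fun i : Fin n => (P.obs (ω i).state, (ω i).action)

theorem obsHistory_succ (n : ℕ) (ω : ℕ → RunStep S Act) :
    P.obsHistory (n + 1) ω = P.obsHistory n ω ++ [(P.obs (ω n).state, (ω n).action)] := by
  rw [obsHistory, List.ofFn_succ', List.concat_eq_append]
  rfl

theorem map_histList_frestrictLe (n : ℕ) (ω : ℕ → RunStep S Act) :
    (Policy.histList (Preorder.frestrictLe (π := fun _ => RunStep S Act) n ω)).map
      (fun p => (P.obs p.1, p.2)) = P.obsHistory (n + 1) ω := by
  rw [Policy.histList, List.map_ofFn]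
  rfl

/-! ### The random safe policy and its Markov chain -/

section SafePolicy

variable [Finite Act]

variable (P) in
/-- A uniformly random candidate action. -/
def candidateDist (W : Set (Set S)) (b : Set S) (s : S) : PMF Act :=
  PMF.uniformOfFinset (P.candidateActions W b (P.obs s)).toFinite.toFinset
    (by simpa using candidateActions_nonempty W b s)

theorem support_candidateDist (W : Set (Set S)) (b : Set S) (s : S) :
    (P.candidateDist W b s).support = P.candidateActions W b (P.obs s) := by
  simp [candidateDist]

theorem candidateDist_congr (W : Set (Set S)) (b : Set S) {s s' : S} (h : P.obs s = P.obs s') :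
    P.candidateDist W b s = P.candidateDist W b s' := by
  simp only [candidateDist, h]

variable (P) in
/-- The policy that tracks the belief support and selects safe actions uniformly at random. -/
def safePolicy (W : Set (Set S)) (b : Set S) : P.Policy where
  act π := P.candidateDist W (P.trackedBelief b (P.obsPath π)) π.2
  support_subset π := by
    rw [support_candidateDist, ← enabledObs_obs]
    exact candidateActions_subset W _ _

theorem safePolicy_observationBased (W : Set (Set S)) (b : Set S) :
    (P.safePolicy W b).ObservationBased := by
  intro π π' h
  simp only [safePolicy, h]
  exact candidateDist_congr W _ (congrArg Prod.snd h)

variable (P) in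
/-- One step of the safe policy: the belief support is updated, and a new action is selected. -/
def safeStep (W : Set (Set S)) (u : Set S × RunStep S Act) : PMF (Set S × RunStep S Act) :=
  (P.succDist u.2.state u.2.action).bind fun s' =>
    (P.candidateDist W (P.succOn u.1 u.2.action (P.obs s')) s').map fun α' =>
      (P.succOn u.1 u.2.action (P.obs s'), ⟨s', α'⟩)

theorem mem_support_safeStep {W : Set (Set S)} {u v : Set S × RunStep S Act} :
    v ∈ (P.safeStep W u).support ↔ v.2.state ∈ (P.succDist u.2.state u.2.action).support ∧
      v.1 = P.succOn u.1 u.2.action (P.obs v.2.state) ∧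
      v.2.action ∈ P.candidateActions W v.1 (P.obs v.2.state) := by
  simp only [safeStep, PMF.mem_support_bind_iff, PMF.mem_support_map_iff, support_candidateDist]
  constructor
  · rintro ⟨s', hs', α', hα', rfl⟩
    exact ⟨hs', rfl, hα'⟩
  · rintro ⟨hs, hb, hα⟩
    refine ⟨_, hs, v.2.action, hb ▸ hα, ?_⟩
    rw [← hb]

variable (P) in
/-- The belief support at time `n`, and the state and action at that time. -/
def beliefNode (b : Set S) (n : ℕ) (ω : ℕ → RunStep S Act) : Set S × RunStep S Act :=
  (P.trackedBelief b (P.obsHistory n ω, P.obs (ω n).state), ω n)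

variable [Finite S]

/-- The policy reads the history only through the tracked support and the current observation, and
the support is updated by one application of `succOn`. -/
theorem isMarkovChain_beliefNode (W : Set (Set S)) (b : Set S) (μ : PMF S) :
    IsMarkovChain ((P.safePolicy W b).runMeasure μ) (P.beliefNode b) (P.safeStep W) where
  measurableSet_preimage n s := by
    have : P.beliefNode b n = (fun x : (i : Finset.Iic n) → RunStep S Act =>
        (P.trackedBelief b (List.ofFn fun i : Fin n =>
          (P.obs (x ⟨i, Finset.mem_Iic.2 i.2.le⟩).state, (x ⟨i, Finset.mem_Iic.2 i.2.le⟩).action),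
          P.obs (x ⟨n, Finset.mem_Iic.2 le_rfl⟩).state), x ⟨n, Finset.mem_Iic.2 le_rfl⟩)) ∘
        Preorder.frestrictLe n := rfl
    rw [this, Set.preimage_comp]
    exact Preorder.measurable_frestrictLe n (MeasurableSet.of_discrete)
  lintegral_succ n f := by
    have key := (P.safePolicy W b).lintegral_runMeasure_succ μ n fun x y =>
      f (P.trackedBelief b ((Policy.histList x).map (fun p => (P.obs p.1, p.2)),
        P.obs y.state), y)
    simp only [map_histList_frestrictLe] at key
    refine key.trans (lintegral_congr fun ω => ?_)
    simp only [Policy.nextStep, safeStep, PMF.expect_bind, PMF.expect_map, beliefNode,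
      safePolicy, obsPath, map_histList_frestrictLe, obsHistory_succ, trackedBelief_concat]
    rfl

end SafePolicy

/-! ### Statewise productive regions are winning -/

theorem eq_succOn_of_mem_postSupp {b b' : Set S} {α : Act} {s' : S} (h : b' ∈ P.postSupp b α)
    (hs' : s' ∈ b') : b' = P.succOn b α (P.obs s') := by
  obtain ⟨z, rfl, -⟩ := h
  rw [hs'.1]

theorem SafePath.tail {W : Set (Set S)} {n : ℕ} {b : ℕ → Set S} {α : ℕ → Act}
    (h : P.SafePath W (n + 1) b α) :
    P.SafePath W n (fun i => b (i + 1)) (fun i => α (i + 1)) :=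
  ⟨fun i hi => h.1 (i + 1) (by omega), fun i hi => h.2 (i + 1) (by omega)⟩

/-- A state of `b` outside `reach` needs a path of positive length, whose first action is safe. If
`b` lies in `reach`, absorption makes every available action return to `b`. -/
theorem StatewiseProductive.safeActions_nonempty {φ : P.ReachAvoid} {W : Set (Set S)}
    (h : StatewiseProductive φ W) {b : Set S} (hb : b ∈ W) (hbs : P.IsBeliefSupport b) :
    (P.safeActions W b).Nonempty := by
  by_cases hr : b ⊆ φ.reach
  · obtain ⟨s, hs⟩ := hbs.1
    obtain ⟨α, hα⟩ := enabled_nonempty (P := P) s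
    have hen : α ∈ P.enabledSupp b := fun s' hs' => mem_enabled_congr (hbs.2 _ hs _ hs') hα
    refine ⟨α, hen, ?_⟩
    rintro b' ⟨z, rfl, s₁, hz, s₂, hs₂, hs₁⟩
    have habs : ∀ x ∈ b, P.post x α = {x} := fun x hx =>
      φ.reach_absorbing x (hr hx) α (hen x hx)
    rw [habs _ hs₂] at hs₁
    obtain rfl : s₁ = s₂ := hs₁
    suffices P.succOn b α z = b by rwa [this]
    ext x
    constructor
    · rintro ⟨-, y, hy, hxy⟩
      rw [habs y hy] at hxy
      obtain rfl : x = y := hxy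
      exact hy
    · intro hx
      exact ⟨(hbs.2 _ hx _ hs₂).trans hz, x, hx, by rw [habs x hx]; rfl⟩
  · obtain ⟨s, hs, hsr⟩ := Set.not_subset.1 hr
    obtain ⟨n, b', α, hsafe, rfl, t, rfl, -, -, ht⟩ := h b hb s hs
    cases n with
    | zero => exact absurd ht hsr
    | succ n =>
      obtain ⟨h1, -, h3⟩ := hsafe.2 0 n.succ_pos
      exact ⟨α 0, h1, h3⟩

/-- A node already contains its next action, so the initial action `β` has to be produced together
with the path. -/
theorem exists_reflTransGen_safeStep [Finite Act] {φ : P.ReachAvoid} {W : Set (Set S)}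
    (hne : ∀ b ∈ W, (P.safeActions W b).Nonempty) (n : ℕ) :
    ∀ (b : ℕ → Set S) (α : ℕ → Act) (s : ℕ → S), P.SafePath W n b α →
      (∀ i ≤ n, s i ∈ b i) → (∀ i < n, s (i + 1) ∈ P.post (s i) (α i)) → s n ∈ φ.reach →
      ∃ β ∈ P.safeActions W (b 0), ∃ v : Set S × RunStep S Act, v.2.state ∈ φ.reach ∧
        Relation.ReflTransGen (fun x y => y ∈ (P.safeStep W x).support) (b 0, ⟨s 0, β⟩) v := by
  induction n with
  | zero =>
    intro b α s hsafe _ _ hr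
    obtain ⟨β, hβ⟩ := hne _ (hsafe.1 0 le_rfl)
    exact ⟨β, hβ, _, hr, .refl⟩
  | succ n ih =>
    intro b α s hsafe hmem hpost hr
    obtain ⟨β, hβ, v, hv, hpath⟩ := ih _ _ (fun i => s (i + 1)) hsafe.tail
      (fun i hi => hmem (i + 1) (by omega)) (fun i hi => hpost (i + 1) (by omega)) hr
    obtain ⟨h1, h2, h3⟩ := hsafe.2 0 n.succ_pos
    refine ⟨α 0, ⟨h1, h3⟩, v, hv, .head ?_ hpath⟩
    rw [mem_support_safeStep]
    have hs1 : s 1 ∈ b 1 := hmem 1 (by omega)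
    refine ⟨?_, eq_succOn_of_mem_postSupp h2 hs1, ?_⟩
    · change s 1 ∈ _
      rw [support_succDist (h1 _ (hmem 0 (by omega)))]
      exact hpost 0 n.succ_pos
    · exact (candidateActions_eq hs1 ⟨β, hβ⟩).symm ▸ hβ

/-- A statewise productive set of belief supports without states to be avoided is a winning
region: the policy that selects safe actions uniformly at random is winning. -/
theorem StatewiseProductive.winningRegion [Finite S] [Finite Act] {φ : P.ReachAvoid}
    {W : Set (Set S)} (h : StatewiseProductive φ W)
    (hW : ∀ b ∈ W, P.IsBeliefSupport b) (havoid : ∀ b ∈ W, ∀ s ∈ b, s ∉ φ.avoid) :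
    WinningRegion φ W := by
  intro b hb
  refine ⟨hW b hb, P.safePolicy W b, safePolicy_observationBased W b, fun μ hμ => ?_⟩
  have hne : ∀ b ∈ W, (P.safeActions W b).Nonempty := fun b hb =>
    h.safeActions_nonempty hb (hW b hb)
  have hchain := isMarkovChain_beliefNode (P := P) W b μ
  set G : Set (Set S × RunStep S Act) :=
    {u | u.1 ∈ W ∧ u.2.state ∈ u.1 ∧ u.2.action ∈ P.safeActions W u.1} with hGdef
  set T : Set (Set S × RunStep S Act) := {u | u.2.state ∈ φ.reach} with hTdef
  have hT : ∀ u ∈ T, (P.safeStep W u).support ⊆ T := by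
    intro u hu v hv
    have := (φ.reach_absorbing _ hu).support_succDist_subset _ (mem_support_safeStep.1 hv).1
    change v.2.state ∈ φ.reach
    rw [show v.2.state = u.2.state from this]
    exact hu
  have hnext : ∀ u ∈ G, ∀ s' ∈ (P.succDist u.2.state u.2.action).support,
      s' ∈ P.succOn u.1 u.2.action (P.obs s') ∧ P.succOn u.1 u.2.action (P.obs s') ∈ W := by
    rintro u ⟨-, hs, hα⟩ s' hs'
    rw [support_succDist (hα.1 _ hs)] at hs'
    have hmem : s' ∈ P.succOn u.1 u.2.action (P.obs s') := ⟨rfl, _, hs, hs'⟩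
    exact ⟨hmem, hα.2 ⟨_, rfl, ⟨s', hmem⟩⟩⟩
  have hG : ∀ u ∈ G, (P.safeStep W u).support ⊆ G := by
    intro u hu v hv
    obtain ⟨h1, h2, h3⟩ := mem_support_safeStep.1 hv
    obtain ⟨h4, h5⟩ := hnext u hu _ h1
    rw [← h2] at h4 h5
    exact ⟨h5, h4, candidateActions_eq h4 (hne _ h5) ▸ h3⟩
  -- The action in `u` is fixed and need not start a path to `reach`. Being safe, it leads to a
  -- support in `W`, and productivity is applied there.
  have hreach : ∀ u ∈ G, ∃ v ∈ T,
      Relation.ReflTransGen (fun x y => y ∈ (P.safeStep W x).support) u v := by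
    intro u hu
    obtain ⟨s', hs'⟩ := (P.succDist u.2.state u.2.action).support_nonempty
    obtain ⟨h4, h5⟩ := hnext u hu _ hs'
    obtain ⟨n, c, α, hsafe, hc, t, rfl, hmem, hpost, hr⟩ := h _ h5 _ h4
    obtain ⟨β, hβ, v, hv, hpath⟩ := exists_reflTransGen_safeStep hne n c α t hsafe hmem hpost hr
    refine ⟨v, hv, .head ?_ hpath⟩
    rw [mem_support_safeStep]
    refine ⟨hs', hc, ?_⟩
    rw [candidateActions_eq (hmem 0 n.zero_le) ⟨β, hβ⟩]
    exact hβ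
  have h0 : ∀ᵐ ω ∂(P.safePolicy W b).runMeasure μ, P.beliefNode b 0 ω ∈ G := by
    filter_upwards [(P.safePolicy W b).ae_zero_mem_support μ] with ω hω
    simp only [Policy.initStep, PMF.mem_support_bind_iff, PMF.mem_support_map_iff, hμ] at hω
    obtain ⟨s, hs, α, hα, hω⟩ := hω
    have htr := trackedBelief_nil (hW b hb) hs
    have hproc : P.beliefNode b 0 ω = (b, ⟨s, α⟩) := by
      rw [beliefNode, ← hω]
      exact Prod.ext htr rfl
    rw [hproc]
    refine ⟨hb, hs, ?_⟩
    change α ∈ (P.candidateDist W (P.trackedBelief b ([], P.obs s)) s).support at hα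
    rwa [htr, support_candidateDist, candidateActions_eq hs (hne b hb)] at hα
  constructor
  · have hall := ae_all_iff.2 (hchain.ae_mem hG h0)
    refine measure_mono_null ?_ hall
    rintro ω ⟨n, hn⟩ hω
    exact havoid _ (hω n).1 _ (hω n).2.1 hn
  · exact hchain.measure_exists_mem_eq_one hT hG hreach h0

end POMDP

namespace POMDP

variable {S Act Ω : Type*} {P : POMDP S Act Ω}

/-! ### Paths to `reach` along safe paths -/

/-- There is a path from `s` to a state in `reach` that runs along a safe path from `b`. -/
def SafelyReaches (φ : P.ReachAvoid) (W : Set (Set S)) (b₀ : Set S) (s₀ : S) : Prop :=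
  ∃ n b α, P.SafePath W n b α ∧ b 0 = b₀ ∧
    ∃ s : ℕ → S, s 0 = s₀ ∧ (∀ i ≤ n, s i ∈ b i) ∧ (∀ i < n, s (i + 1) ∈ P.post (s i) (α i)) ∧
      s n ∈ φ.reach

theorem SafelyReaches.mono {φ : P.ReachAvoid} {W W' : Set (Set S)} (hWW : W ⊆ W') {b : Set S}
    {s : S} (h : SafelyReaches φ W b s) : SafelyReaches φ W' b s := by
  obtain ⟨n, c, α, hsafe, h⟩ := h
  exact ⟨n, c, α, ⟨fun i hi => hWW (hsafe.1 i hi), fun i hi =>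
    ⟨(hsafe.2 i hi).1, (hsafe.2 i hi).2.1, (hsafe.2 i hi).2.2.trans hWW⟩⟩, h⟩

theorem SafelyReaches.of_mem_reach {φ : P.ReachAvoid} {W : Set (Set S)} {b : Set S} {s : S}
    (hb : b ∈ W) (hs : s ∈ b) (hr : s ∈ φ.reach) : SafelyReaches φ W b s := by
  obtain ⟨α, -⟩ := enabled_nonempty (P := P) s
  exact ⟨0, fun _ => b, fun _ => α, ⟨fun _ _ => hb, fun _ hi => absurd hi (Nat.not_lt_zero _)⟩, rfl,
    fun _ => s, rfl, fun _ _ => hs, fun _ hi => absurd hi (Nat.not_lt_zero _), hr⟩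

theorem SafelyReaches.cons {φ : P.ReachAvoid} {W : Set (Set S)} {b : Set S} {s s' : S} {α : Act}
    (hb : b ∈ W) (hs : s ∈ b) (hα : α ∈ P.safeActions W b) (hs' : s' ∈ P.post s α)
    (h : SafelyReaches φ W (P.succOn b α (P.obs s')) s') : SafelyReaches φ W b s := by
  obtain ⟨n, c, β, hsafe, hc, t, ht, hmem, hpost, hr⟩ := h
  have hne : (P.succOn b α (P.obs s')).Nonempty := ⟨s', rfl, s, hs, hs'⟩
  refine ⟨n + 1, fun i => Nat.casesOn i b c, fun i => Nat.casesOn i α β, ⟨?_, ?_⟩, rfl,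
    fun i => Nat.casesOn i s t, rfl, ?_, ?_, hr⟩
  · rintro (_ | i) hi
    · exact hb
    · exact hsafe.1 i (by omega)
  · rintro (_ | i) hi
    · exact ⟨hα.1, ⟨P.obs s', hc, by simpa [hc] using hne⟩, hα.2⟩
    · exact hsafe.2 i (by omega)
  · rintro (_ | i) hi
    · exact hs
    · exact hmem i (by omega)
  · rintro (_ | i) hi
    · change t 0 ∈ P.post s α
      rwa [ht]
    · exact hpost i (by omega)

/-- If `reach` can be told apart by observation from the states outside `reach ∪ avoid`, then
statewise productivity implies productivity. -/
theorem StatewiseProductive.productive {φ : P.ReachAvoid} {W : Set (Set S)}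
    (h : StatewiseProductive φ W) (hobs : ReachObservable φ)
    (hW : ∀ b ∈ W, P.IsBeliefSupport b) (havoid : ∀ b ∈ W, ∀ s ∈ b, s ∉ φ.avoid) :
    Productive φ W := by
  intro b hb
  obtain ⟨s, hs⟩ := (hW b hb).1
  obtain ⟨n, c, α, hsafe, hc, t, -, hmem, -, hr⟩ := h b hb s hs
  have hn := hsafe.1 n le_rfl
  refine ⟨n, c, α, hsafe, hc, fun x hx => ?_⟩
  by_contra hxr
  exact hobs _ hr x hxr (havoid _ hn x hx) ((hW _ hn).2 _ (hmem n le_rfl) _ hx)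

/-! ### The invariant of the algorithm -/

/-- All stored sets consist of states with the respective observation, outside `avoid`, and the
encoded region is statewise productive. -/
structure Invariant (φ : P.ReachAvoid) (w : WinData S Ω) : Prop where
  obs_eq : ∀ z, ∀ X ∈ w z, ∀ s ∈ X, P.obs s = z
  notMem_avoid : ∀ z, ∀ X ∈ w z, ∀ s ∈ X, s ∉ φ.avoid
  statewiseProductive : StatewiseProductive φ (P.encodedRegion w)

theorem isBeliefSupport_of_mem_encodedRegion {w : WinData S Ω} {b : Set S}
    (hb : b ∈ P.encodedRegion w) : P.IsBeliefSupport b := by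
  obtain ⟨hne, z, hz, -⟩ := hb
  exact ⟨hne, fun s hs s' hs' => (hz s hs).trans (hz s' hs').symm⟩

theorem Invariant.notMem_avoid_of_mem_encodedRegion {φ : P.ReachAvoid} {w : WinData S Ω}
    (h : Invariant φ w) : ∀ b ∈ P.encodedRegion w, ∀ s ∈ b, s ∉ φ.avoid := by
  rintro b ⟨-, z, -, X, hX, hbX⟩ s hs
  exact h.notMem_avoid z X hX s (hbX hs)

theorem IsInitial.invariant {φ : P.ReachAvoid} {w : WinData S Ω} (h : IsInitial φ w) :
    Invariant φ w where
  obs_eq z X hX s hs := by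
    rw [(h z).sound X hX] at hs
    exact hs.2
  notMem_avoid z X hX s hs := by
    rw [(h z).sound X hX] at hs
    exact Set.disjoint_left.1 φ.disjoint hs.1
  statewiseProductive b hb s hs := by
    refine SafelyReaches.of_mem_reach hb hs ?_
    obtain ⟨-, z, -, X, hX, hbX⟩ := hb
    have := hbX hs
    rw [(h z).sound X hX] at this
    exact this.1

/-- Index 0 and indices beyond the length yield `∅`, so an inhabited entry is a stored set. -/
theorem mem_of_mem_entry {L : List (Set S)} {i : ℕ} {s : S} (h : s ∈ entry L i) :
    ∃ X ∈ L, entry L i = X := by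
  cases i with
  | zero => exact absurd h (Set.notMem_empty s)
  | succ i =>
    refine ⟨_, ?_, rfl⟩
    by_cases hi : i < L.length
    · simp [entry, hi]
    · simp [entry, not_lt.1 hi] at h

/-- Belief supports at which a shortcut is taken are already encoded. -/
theorem Satisfies.mem_encodedRegion_of_shortcut {φ : P.ReachAvoid} {w : WinData S Ω}
    {η : Assignment S Act Ω} (h : Satisfies φ w η) {b : Set S} {z : Ω} (hne : b.Nonempty)
    (hz : ∀ s ∈ b, P.obs s = z) (hD : ∀ s ∈ b, η.D s) : b ∈ P.encodedRegion w := by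
  have hmem : ∀ s ∈ b, s ∈ entry (w z) (η.idx z) := fun s hs => by
    by_contra hn
    exact h.shortcut_mem z _ (h.shortcut_le z) s hn (hz s hs) (hD s hs) rfl
  obtain ⟨s, hs⟩ := hne
  obtain ⟨X, hX, hXe⟩ := mem_of_mem_entry (hmem s hs)
  exact ⟨⟨s, hs⟩, z, hz, X, hX, fun x hx => hXe ▸ hmem x hx⟩

/-! ### Effect of one iteration -/

section Iteration

variable {φ : P.ReachAvoid} {w w' : WinData S Ω} {η : Assignment S Act Ω}

/-- A set may be dropped only if a stored set contains it, and the region is closed under nonempty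
subsets. -/
theorem encodedRegion_subset
    (hst : ∀ z, Stores (w' z) ({X | X ∈ w z} ∪ {{s | P.obs s = z ∧ η.C s}})) :
    P.encodedRegion w ⊆ P.encodedRegion w' := by
  rintro b ⟨hne, z, hz, X, hX, hbX⟩
  obtain ⟨Y, hY, hXY⟩ := (hst z).covers X (.inl hX) (hne.mono hbX)
  exact ⟨hne, z, hz, Y, hY, hbX.trans hXY⟩

theorem mem_encodedRegion_of_C
    (hst : ∀ z, Stores (w' z) ({X | X ∈ w z} ∪ {{s | P.obs s = z ∧ η.C s}}))
    {b : Set S} {z : Ω} (hne : b.Nonempty) (hb : ∀ s ∈ b, P.obs s = z ∧ η.C s) :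
    b ∈ P.encodedRegion w' := by
  obtain ⟨Y, hY, hXY⟩ := (hst z).covers _ (.inr rfl) (hne.mono hb)
  exact ⟨hne, z, fun s hs => (hb s hs).1, Y, hY, fun s hs => hXY (hb s hs)⟩

/-- Induction on the rank of `s` for all `b` at once, as the support changes along the path. Only
the followed state must lose rank; the other states of `b` merely have to stay in C or D. -/
theorem Satisfies.safelyReaches_of_C [Finite S] (hη : Satisfies φ w η)
    (hst : ∀ z, Stores (w' z) ({X | X ∈ w z} ∪ {{s | P.obs s = z ∧ η.C s}}))
    (h : StatewiseProductive φ (P.encodedRegion w)) (s : S) :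
    ∀ b : Set S, s ∈ b → (∀ x ∈ b, P.obs x = P.obs s ∧ η.C x) →
      SafelyReaches φ (P.encodedRegion w') b s := by
  have hwf : WellFounded fun x y : S => η.rank x < η.rank y :=
    have : IsTrans S fun x y => η.rank x < η.rank y := ⟨fun _ _ _ => lt_trans⟩
    have : Std.Irrefl fun x y : S => η.rank x < η.rank y := ⟨fun _ => lt_irrefl _⟩
    Finite.wellFounded_of_trans_of_irrefl _
  induction s using hwf.induction with
  | _ s ih =>
  intro b hs hb
  have hbW : b ∈ P.encodedRegion w' := mem_encodedRegion_of_C hst ⟨s, hs⟩ hb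
  have hen : ∀ α ∈ P.enabled s, α ∈ P.enabledSupp b := fun α hα x hx =>
    mem_enabled_congr (hb x hx).1.symm hα
  by_cases hr : s ∈ φ.reach
  · exact .of_mem_reach hbW hs hr
  by_cases hsw : η.switch (P.obs s)
  · obtain ⟨α, hα, hA⟩ := hη.action _ ⟨s, rfl⟩
    rw [enabledObs_obs] at hα
    -- All states of `b` share the observation that selects `α` and the switch, so all their
    -- successors are D-states.
    have hpost : P.postSupp b α ⊆ P.encodedRegion w := by
      rintro b' ⟨z, rfl, hne⟩
      refine hη.mem_encodedRegion_of_shortcut hne (fun x hx => hx.1) ?_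
      rintro x ⟨-, y, hy, hxy⟩
      refine hη.closed_switch y α (hen α hα y hy) ⟨(hb y hy).2, ?_, ?_⟩ x hxy <;>
        rwa [(hb y hy).1]
    obtain ⟨s', hs'⟩ := hα
    have hmem : s' ∈ P.succOn b α (P.obs s') := ⟨rfl, s, hs, hs'⟩
    have hsub := encodedRegion_subset hst
    exact .cons hbW hs ⟨hen α ⟨s', hs'⟩, hpost.trans hsub⟩ hs'
      (SafelyReaches.mono hsub (h _ (hpost ⟨_, rfl, ⟨s', hmem⟩⟩) _ hmem))
  · obtain ⟨α, hα, hA, s', hs', hlt⟩ :=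
      (hη.ranking s hr (fun ha => (hη.avoid s ha).1 (hb s hs).2) (hb s hs).2).resolve_right hsw
    have hC : ∀ y ∈ b, ∀ x ∈ P.post y α, η.C x := fun y hy x hx => by
      refine hη.closed y α (hen α hα y hy) ⟨(hb y hy).2, ?_, ?_⟩ x hx <;>
        rwa [(hb y hy).1]
    refine .cons hbW hs ⟨hen α hα, ?_⟩ hs' (ih s' hlt _ ⟨rfl, s, hs, hs'⟩ ?_)
    · rintro b' ⟨z, rfl, hne⟩
      exact mem_encodedRegion_of_C hst hne fun x ⟨hx, y, hy, hxy⟩ => ⟨hx, hC y hy x hxy⟩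
    · rintro x ⟨hx, y, hy, hxy⟩
      exact ⟨hx, hC y hy x hxy⟩

theorem Iteration.invariant [Finite S] (hit : Iteration φ w w') (h : Invariant φ w) :
    Invariant φ w' := by
  obtain ⟨η, hη, hst⟩ := hit
  refine ⟨fun z X hX s hs => ?_, fun z X hX s hs => ?_, fun b hb s hs => ?_⟩
  · rcases (hst z).sound X hX with hX | rfl
    · exact h.obs_eq z X hX s hs
    · exact hs.1
  · rcases (hst z).sound X hX with hX | rfl
    · exact h.notMem_avoid z X hX s hs
    · exact fun ha => (hη.avoid s ha).1 hs.2
  · obtain ⟨hne, z, hz, X, hX, hbX⟩ := hb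
    rcases (hst z).sound X hX with hX | rfl
    · exact SafelyReaches.mono (encodedRegion_subset hst)
        (h.statewiseProductive b ⟨hne, z, hz, X, hX, hbX⟩ s hs)
    · refine hη.safelyReaches_of_C hst h.statewiseProductive s b hs fun x hx => ?_
      exact ⟨(hz x hx).trans (hz s hs).symm, (hbX hx).2⟩

/-- Each iteration adds a new belief support. -/
theorem Iteration.encodedRegion_ssubset (hit : Iteration φ w w') :
    P.encodedRegion w ⊂ P.encodedRegion w' := by
  obtain ⟨η, hη, hst⟩ := hit
  obtain ⟨z, hU⟩ := hη.progress
  refine (Set.ssubset_iff_of_subset (encodedRegion_subset hst)).2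
    ⟨{s | P.obs s = z ∧ η.C s}, mem_encodedRegion_of_C (z := z) hst ?_ fun _ hs => hs, ?_⟩
  · by_cases hw : w z = []
    · exact (hη.updated_of_empty z hw).1 hU
    · obtain ⟨X, hX⟩ := List.exists_mem_of_ne_nil _ hw
      obtain ⟨s, -, hs⟩ := (hη.updated_of_nonempty z hw).1 hU X hX
      exact ⟨s, hs⟩
  · rintro ⟨⟨x, hx⟩, z', hz', X, hX, hsub⟩
    -- A nonempty support determines its observation, so only a set in `w z` could encode it, and
    -- `U` excludes each of those.
    obtain rfl : z = z' := hx.1.symm.trans (hz' x hx)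
    obtain ⟨s, hsX, hs⟩ := (hη.updated_of_nonempty z (List.ne_nil_of_mem hX)).1 hU X hX
    exact hsX (hsub hs)

end Iteration

theorem AfterIterations.invariant [Finite S] {φ : P.ReachAvoid} {n : ℕ} {w : WinData S Ω}
    (h : AfterIterations φ n w) : Invariant φ w := by
  induction h with
  | init h => exact h.invariant
  | step _ hit ih => exact hit.invariant ih

theorem AfterIterations.le_ncard [Finite S] {φ : P.ReachAvoid} {n : ℕ} {w : WinData S Ω}
    (h : AfterIterations φ n w) : n ≤ (P.encodedRegion w).ncard := by
  induction h with
  | init h => exact Nat.zero_le _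
  | step _ hit ih => exact ih.trans_lt (Set.ncard_lt_ncard hit.encodedRegion_ssubset)

end POMDP

end

theorem theorem2 {S Act Ω : Type*} [Finite S] [Finite Act] [Finite Ω]
    (P : POMDP S Act Ω) (φ : P.ReachAvoid) :
    (∀ (n : ℕ) (w : POMDP.WinData S Ω), POMDP.AfterIterations φ n w →
      (∀ z, ∀ X ∈ w z, X.Nonempty → X ∈ P.encodedRegion w) ∧
      POMDP.WinningRegion φ (P.encodedRegion w) ∧
      POMDP.StatewiseProductive φ (P.encodedRegion w) ∧
      (POMDP.ReachObservable φ → POMDP.Productive φ (P.encodedRegion w))) ∧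
    ∃ N : ℕ, ∀ (n : ℕ) (w : POMDP.WinData S Ω), POMDP.AfterIterations φ n w → n ≤ N := by
  refine ⟨fun n w h => ?_, Nat.card (Set S), fun n w h => ?_⟩
  · have hinv := h.invariant
    have hW : ∀ b ∈ P.encodedRegion w, P.IsBeliefSupport b := fun b hb =>
      POMDP.isBeliefSupport_of_mem_encodedRegion hb
    have havoid := hinv.notMem_avoid_of_mem_encodedRegion
    exact ⟨fun z X hX hne => ⟨hne, z, hinv.obs_eq z X hX, X, hX, subset_rfl⟩,
      hinv.statewiseProductive.winningRegion hW havoid, hinv.statewiseProductive,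
      fun hobs => hinv.statewiseProductive.productive hobs hW havoid⟩
  · exact h.le_ncard.trans (Set.ncard_le_card _)
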